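/- Let $q,\alpha,a,b\in\mathbb{C}$ with $0<|q|<1$, $a\ne0$, $b\ne0$ and $|\alpha ab/q|<1$. Let $q^{1/3}$ and $\alpha^{1/3}$ denote any fixed cube roots of $q$ and $\alpha$, and write $q^{m/3}=(q^{1/3})^m$ and $\alpha^{m/3}=(\alpha^{1/3})^m$ for integers $m$; in particular $q^{(3n^2-7n)/6}=(q^{1/3})^{(3n^2-7n)/2}$, where $(3n^2-7n)/2$ is an integer. Write $(x;q)_n=\prod_{k=0}^{n-1}(1-xq^k)$ for $n\in\{0,1,2,\dots\}\cup\{\infty\}$ and $(x,y;q)_n=(x;q)_n(y;q)_n$. Suppose that no denominator vanishes, that is, $\alpha q^{k+1}\neq1$, $\alpha aq^k\ne1$ and $\alpha bq^k\neq1$ for all integers $k\ge0$. Then both series below converge absolutely, and \begin{align*} &\frac{(\alpha q,\alpha ab/q;q)_\infty}{(\alpha a,\alpha b;q)_\infty} \sum_{n=0}^\infty\frac{(q/a,q/b;q)_n\,(\alpha^{1/3}q^{1/3};q^{1/3})_{3n}}{(q;q)_n(\alpha q;q)_{2n}}\left(\frac{\alpha ab}{q}\right)^n\\ &\quad=\sum_{n=0}^\infty(-1)^n\,\frac{1-\alpha^{1/3}q^{2n/3}}{1-\alpha^{1/3}}\,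 \frac{(q/a,q/b;q)_n\,(\alpha^{1/3};q^{1/3})_n}{(\alpha a,\alpha b;q)_n\,(q^{1/3};q^{1/3})_n}\,\alpha^{4n/3}a^nb^nq^{(3n^2-7n)/6}. \end{align*} When $\alpha^{1/3}=1$, the factor $\frac{1-\alpha^{1/3}q^{2n/3}}{1-\alpha^{1/3}}\cdot\frac{(\alpha^{1/3};q^{1/3})_n}{(q^{1/3};q^{1/3})_n}$ on the right is understood as its limit, which is $1$ for $n=0$ and $1+q^{n/3}$ for $n\ge1$. -/

import Mathlib

/-- The finite `q`-shifted factorial `(a; q)_n = ∏_{k=0}^{n-1} (1 - a q^k)`. -/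
noncomputable def qShifted (a q : ℂ) (n : ℕ) : ℂ :=
  ∏ k ∈ Finset.range n, (1 - a * q ^ k)

/-- The infinite `q`-shifted factorial `(a; q)_∞ = ∏_{k=0}^{∞} (1 - a q^k)`. -/
noncomputable def qShiftedInf (a q : ℂ) : ℂ :=
  ∏' k : ℕ, (1 - a * q ^ k)

/-- For `|q| < 1` the infinite product `(a; q)_∞` converges, and it is the limit of `(a; q)_n`. -/
theorem tendsto_qShifted (a q : ℂ) (hq : ‖q‖ < 1) :
    Filter.Tendsto (qShifted a q) Filter.atTop (nhds (qShiftedInf a q)) := by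
  have h : Multipliable (fun k : ℕ => 1 + -(a * q ^ k)) := by
    apply multipliable_one_add_of_summable
    simp only [norm_neg, norm_mul, norm_pow]
    exact (summable_geometric_of_lt_one (norm_nonneg q) hq).mul_left _
  simp only [← sub_eq_add_neg] at h
  exact h.hasProd.tendsto_prod_nat

/-!
Put `p = q^{1/3}`, `t = α^{1/3}` and let `ω` be a primitive cube root of unity. In base `p`, the
terminating very-well-poised `₆φ₅` series with parameters `t; ω² p^{-n}, ω p^{-n}, p^{-n}` is
summable in closed form, and since `(1 - z)(1 - ωz)(1 - ω²z) = 1 - z³` the shifted factorials of its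
last three parameters merge into shifted factorials in base `p³ = q`. The resulting identity says
that `β_n = (tp; p)_{3n} / ((q; q)_n (αq; q)_{2n})` is the second half of a Bailey pair relative to
`α`. The theorem is Bailey's lemma for this pair, with parameters `q/a` and `q/b`; Bailey's lemma
itself is the `q`-Gauss summation after interchanging two sums. Both summations come from
contiguous relations that telescope.
-/

open Filter Topology Finset

section General

theorem norm_mul_pow_le {R : Type*} [SeminormedRing R] [NormOneClass R] {q : R} (hq : ‖q‖ ≤ 1)
    (x : R) (k : ℕ) : ‖x * q ^ k‖ ≤ ‖x‖ :=
  (norm_mul_le _ _).trans <| mul_le_of_le_one_right (norm_nonneg x) <|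
    (norm_pow_le q k).trans (pow_le_one₀ (norm_nonneg q) hq)

theorem norm_pow_lt_one {R : Type*} [SeminormedRing R] [NormOneClass R] {x : R} (hx : ‖x‖ < 1)
    {n : ℕ} (hn : n ≠ 0) : ‖x ^ n‖ < 1 :=
  (norm_pow_le x n).trans_lt (pow_lt_one₀ (norm_nonneg x) hx hn)

theorem mul_pow_ne_one_of_norm_lt_one {R : Type*} [SeminormedRing R] [NormOneClass R] {x q : R}
    (hx : ‖x‖ < 1) (hq : ‖q‖ ≤ 1) (k : ℕ) : x * q ^ k ≠ 1 := fun h =>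
  ((norm_mul_pow_le hq x k).trans_lt hx).ne (by rw [h, norm_one])

theorem mul_pow_ne_one_of_pow_mul_pow_ne_one {M : Type*} [CommMonoid M] {x p : M} {n : ℕ}
    (h : ∀ k : ℕ, x ^ n * (p ^ n) ^ k ≠ 1) (k : ℕ) : x * p ^ k ≠ 1 := fun hxp =>
  h k <| by rw [pow_right_comm, ← mul_pow, hxp, one_pow]

theorem exists_pos_norm_le_of_tendsto {E : Type*} [SeminormedAddCommGroup E] {u : ℕ → E} {l : E}
    (h : Tendsto u atTop (𝓝 l)) : ∃ M > 0, ∀ n, ‖u n‖ ≤ M := by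
  simpa only [Set.forall_mem_range] using (Metric.isBounded_range_of_tendsto u h).exists_pos_norm_le

theorem hasSum_sum_antidiagonal {A M : Type*} [AddMonoid A] [HasAntidiagonal A] [AddCommMonoid M]
    [TopologicalSpace M] [ContinuousAdd M] [RegularSpace M] {f : A × A → M} {s : M}
    (hf : HasSum f s) : HasSum (fun n => ∑ ij ∈ antidiagonal n, f ij) s := by
  refine (HasAntidiagonal.sigmaAntidiagonalEquivProd.hasSum_iff.2 hf).sigma fun n => ?_
  simpa only [sum_coe_sort (antidiagonal n) f] using!
    hasSum_fintype fun ij : antidiagonal n => f ij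

theorem choose_two_succ (n : ℕ) : (n + 1).choose 2 = n + n.choose 2 := by
  rw [Nat.choose_succ_succ' n 1, Nat.choose_one_right]

theorem zpow_three_mul_sq_sub_seven_mul_div_two {G : Type*} [CommGroupWithZero G] {p : G}
    (hp : p ≠ 0) (n : ℕ) :
    p ^ ((3 * (n : ℤ) ^ 2 - 7 * (n : ℤ)) / 2) = p ^ n * (p ^ 3) ^ n.choose 2 / (p ^ 3) ^ n := by
  have hchoose : 2 * (n.choose 2 : ℤ) = (n : ℤ) ^ 2 - n := by
    induction n with
    | zero => simp
    | succ n ih =>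
      rw [choose_two_succ]
      push_cast
      linear_combination ih
  have hexp : (3 * (n : ℤ) ^ 2 - 7 * (n : ℤ)) / 2
      = ((n + 3 * n.choose 2 : ℕ) : ℤ) - ((3 * n : ℕ) : ℤ) := by
    refine Int.ediv_eq_of_eq_mul_right two_ne_zero ?_
    push_cast
    linear_combination -3 * hchoose
  rw [hexp, zpow_sub₀ hp, zpow_natCast, zpow_natCast, pow_add, pow_mul, pow_mul]

theorem summable_pow_mul_pow_choose_two {𝕜 : Type*} [NormedField 𝕜] [CompleteSpace 𝕜] (c : 𝕜)
    {q : 𝕜} (hq : ‖q‖ < 1) : Summable fun n : ℕ => c ^ n * q ^ n.choose 2 := by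
  have ratio_tendsto : Tendsto (fun n : ℕ => ‖c * q ^ n‖) atTop (𝓝 0) := by
    simpa using ((tendsto_pow_atTop_nhds_zero_of_norm_lt_one hq).const_mul c).norm
  refine summable_of_ratio_norm_eventually_le (r := 1 / 2) (by norm_num) ?_
  filter_upwards [ratio_tendsto.eventually (ge_mem_nhds one_half_pos)] with n hn
  rw [choose_two_succ, show c ^ (n + 1) * q ^ (n + n.choose 2)
    = c * q ^ n * (c ^ n * q ^ n.choose 2) by ring, norm_mul]
  gcongr

end General

section ShiftedFactorial

variable {a q : ℂ}

theorem qShifted_zero (a q : ℂ) : qShifted a q 0 = 1 :=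
  prod_range_zero _

theorem qShifted_succ (a q : ℂ) (n : ℕ) :
    qShifted a q (n + 1) = qShifted a q n * (1 - a * q ^ n) :=
  prod_range_succ _ _

theorem qShifted_add (a q : ℂ) (m n : ℕ) :
    qShifted a q (m + n) = qShifted a q m * qShifted (a * q ^ m) q n := by
  simp only [qShifted, prod_range_add, pow_add, mul_assoc]

theorem qShifted_succ' (a q : ℂ) (n : ℕ) :
    qShifted a q (n + 1) = (1 - a) * qShifted (a * q) q n := by
  rw [add_comm, qShifted_add, qShifted_succ, qShifted_zero, pow_zero, pow_one, mul_one, one_mul]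

theorem qShifted_ne_zero (h : ∀ k : ℕ, a * q ^ k ≠ 1) (n : ℕ) : qShifted a q n ≠ 0 :=
  prod_ne_zero_iff.2 fun k _ => sub_ne_zero.2 (h k).symm

theorem mul_pow_mul_pow_ne_one (h : ∀ k : ℕ, a * q ^ k ≠ 1) (m k : ℕ) :
    a * q ^ m * q ^ k ≠ 1 := by
  rw [mul_assoc, ← pow_add]
  exact h (m + k)

theorem qShifted_mul_self (h : a ≠ 1) (n : ℕ) :
    qShifted (a * q) q n = qShifted a q n * (1 - a * q ^ n) / (1 - a) := by
  rw [eq_div_iff (sub_ne_zero.2 h.symm), ← qShifted_succ, qShifted_succ', mul_comm]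

theorem qShiftedInf_ne_zero (hq : ‖q‖ < 1) (h : ∀ k : ℕ, a * q ^ k ≠ 1) :
    qShiftedInf a q ≠ 0 := by
  have hsum : Summable fun k : ℕ => ‖-(a * q ^ k)‖ := by
    simpa only [norm_neg, norm_mul, norm_pow] using
      (summable_geometric_of_lt_one (norm_nonneg q) hq).mul_left ‖a‖
  simpa only [qShiftedInf, sub_eq_add_neg] using tprod_one_add_ne_zero_of_summable
    (fun k => by simpa only [← sub_eq_add_neg] using sub_ne_zero.2 (h k).symm) hsum

theorem qShiftedInf_eq_qShifted_mul (hq : ‖q‖ < 1) (a : ℂ) (n : ℕ) :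
    qShiftedInf a q = qShifted a q n * qShiftedInf (a * q ^ n) q := by
  refine tendsto_nhds_unique ((tendsto_qShifted a q hq).comp (tendsto_add_atTop_nat n)) ?_
  refine ((tendsto_qShifted (a * q ^ n) q hq).const_mul _).congr fun m => ?_
  rw [← qShifted_add, Function.comp_apply, add_comm]

theorem exists_norm_qShifted_le (a : ℂ) (hq : ‖q‖ < 1) : ∃ M > 0, ∀ n, ‖qShifted a q n‖ ≤ M :=
  exists_pos_norm_le_of_tendsto (tendsto_qShifted a q hq)

theorem exists_norm_inv_qShifted_le (hq : ‖q‖ < 1) (h : ∀ k : ℕ, a * q ^ k ≠ 1) :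
    ∃ M > 0, ∀ n, ‖(qShifted a q n)⁻¹‖ ≤ M :=
  exists_pos_norm_le_of_tendsto ((tendsto_qShifted a q hq).inv₀ (qShiftedInf_ne_zero hq h))

theorem exists_norm_inv_qShifted_mul_pow_le (hq : ‖q‖ < 1) (h : ∀ k : ℕ, a * q ^ k ≠ 1) :
    ∃ M > 0, ∀ N n, ‖(qShifted (a * q ^ N) q n)⁻¹‖ ≤ M := by
  obtain ⟨M, hM, hle⟩ := exists_norm_qShifted_le a hq
  obtain ⟨M', hM', hle'⟩ := exists_norm_inv_qShifted_le hq h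
  refine ⟨M * M', by positivity, fun N n => ?_⟩
  have split : (qShifted (a * q ^ N) q n)⁻¹ = qShifted a q N * (qShifted a q (N + n))⁻¹ := by
    rw [qShifted_add, mul_inv, mul_inv_cancel_left₀ (qShifted_ne_zero h N)]
  rw [split, norm_mul]
  gcongr
  exacts [hle N, hle' (N + n)]

end ShiftedFactorial

section QGauss

/-- The general term `(A; q)_m (B; q)_m / ((q; q)_m (c; q)_m) x^m` of the series in the `q`-Gauss
summation. There `x = c / (A B)`; encoding this as `c = x A B` allows `A` or `B` to vanish. -/
noncomputable def qGaussTerm (A B q x : ℂ) (m : ℕ) : ℂ :=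
  qShifted A q m * qShifted B q m / (qShifted q q m * qShifted (x * A * B) q m) * x ^ m

variable {A B q x : ℂ}

theorem exists_norm_qGaussTerm_mul_pow_le (hq : ‖q‖ < 1) (h : ∀ k : ℕ, x * A * B * q ^ k ≠ 1) :
    ∃ M > 0, ∀ N m, ‖qGaussTerm A B q (x * q ^ N) m‖ ≤ M * ‖x * q ^ N‖ ^ m := by
  obtain ⟨MA, hMA, hA⟩ := exists_norm_qShifted_le A hq
  obtain ⟨MB, hMB, hB⟩ := exists_norm_qShifted_le B hq
  obtain ⟨Mq, hMq, hqq⟩ :=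
    exists_norm_inv_qShifted_le hq (mul_pow_ne_one_of_norm_lt_one hq hq.le)
  obtain ⟨Mc, hMc, hc⟩ := exists_norm_inv_qShifted_mul_pow_le hq h
  refine ⟨MA * MB * (Mq * Mc), by positivity, fun N m => ?_⟩
  rw [qGaussTerm, div_eq_mul_inv, mul_inv, show x * q ^ N * A * B = x * A * B * q ^ N by ring]
  simp only [norm_mul _ (_ ^ m), norm_mul _ (_ * _), norm_mul (qShifted _ _ _),
    norm_mul (_ ⁻¹), norm_pow _ m]
  gcongr
  exacts [hA m, hB m, hqq m, hc N m]

theorem summable_qGaussTerm (hq : ‖q‖ < 1) (hx : ‖x‖ < 1) (h : ∀ k : ℕ, x * A * B * q ^ k ≠ 1) :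
    Summable (qGaussTerm A B q x) := by
  obtain ⟨M, -, hM⟩ := exists_norm_qGaussTerm_mul_pow_le hq h
  refine .of_norm_bounded ((summable_geometric_of_lt_one (norm_nonneg x) hx).mul_left M) fun m => ?_
  simpa only [pow_zero, mul_one] using hM 0 m

theorem qGaussTerm_contiguous (hq : ∀ k : ℕ, q * q ^ k ≠ 1)
    (h : ∀ k : ℕ, x * A * B * q ^ k ≠ 1) (m : ℕ) :
    (1 - x * A * B) * (1 - x) * qGaussTerm A B q x m
        - (1 - x * A) * (1 - x * B) * qGaussTerm A B q (x * q) m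
      = (1 - x * A * B) * (1 - q ^ m) * qGaussTerm A B q x m
        - (1 - x * A * B) * (1 - q ^ (m + 1)) * qGaussTerm A B q x (m + 1) := by
  have hC := qShifted_ne_zero h m
  have hQ := qShifted_ne_zero hq m
  have hCm : 1 - x * A * B * q ^ m ≠ 0 := sub_ne_zero.2 (h m).symm
  have hC0 : x * A * B ≠ 1 := by simpa only [pow_zero, mul_one] using h 0
  have hC0' : 1 - x * A * B ≠ 0 := sub_ne_zero.2 hC0.symm
  have hQm : 1 - q ^ m * q ≠ 0 := sub_ne_zero.2 (mul_comm q _ ▸ (hq m).symm)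
  simp only [qGaussTerm, show x * q * A * B = x * A * B * q by ring, qShifted_mul_self hC0,
    qShifted_succ, pow_succ', mul_pow]
  generalize q ^ m = y at *
  field_simp
  ring

theorem tsum_qGaussTerm_contiguous (hq : ‖q‖ < 1) (hx : ‖x‖ < 1)
    (h : ∀ k : ℕ, x * A * B * q ^ k ≠ 1) :
    (1 - x * A * B) * (1 - x) * ∑' m, qGaussTerm A B q x m
      = (1 - x * A) * (1 - x * B) * ∑' m, qGaussTerm A B q (x * q) m := by
  have hsum := summable_qGaussTerm hq hx h
  have hsumq : Summable (qGaussTerm A B q (x * q)) := by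
    refine summable_qGaussTerm hq ?_ fun k => ?_
    · simpa only [pow_one] using (norm_mul_pow_le hq.le x 1).trans_lt hx
    · rw [show x * q * A * B = x * A * B * q ^ 1 by ring]
      exact mul_pow_mul_pow_ne_one h 1 k
  have hdiff := ((hsum.mul_left ((1 - x * A * B) * (1 - x))).hasSum.sub
    (hsumq.mul_left ((1 - x * A) * (1 - x * B))).hasSum).tendsto_sum_nat
  simp only [qGaussTerm_contiguous (mul_pow_ne_one_of_norm_lt_one hq hq.le) h,
    sum_range_sub' fun m => (1 - x * A * B) * (1 - q ^ m) * qGaussTerm A B q x m] at hdiff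
  have hzero : Tendsto (fun m => (1 - x * A * B) * (1 - q ^ 0) * qGaussTerm A B q x 0
      - (1 - x * A * B) * (1 - q ^ m) * qGaussTerm A B q x m) atTop (𝓝 0) := by
    simpa using (((tendsto_pow_atTop_nhds_zero_of_norm_lt_one hq).const_sub 1).const_mul
      (1 - x * A * B)).mul hsum.tendsto_atTop_zero |>.neg
  simpa only [tsum_mul_left, sub_eq_zero] using tendsto_nhds_unique hdiff hzero

theorem qShifted_mul_tsum_qGaussTerm (hq : ‖q‖ < 1) (hx : ‖x‖ < 1)
    (h : ∀ k : ℕ, x * A * B * q ^ k ≠ 1) (N : ℕ) :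
    qShifted (x * A * B) q N * qShifted x q N * ∑' m, qGaussTerm A B q x m
      = qShifted (x * A) q N * qShifted (x * B) q N * ∑' m, qGaussTerm A B q (x * q ^ N) m := by
  induction N with
  | zero => simp only [qShifted_zero, pow_zero, mul_one]
  | succ N ih =>
    have step := tsum_qGaussTerm_contiguous (A := A) (B := B) hq
      ((norm_mul_pow_le hq.le x N).trans_lt hx) fun k => by
        rw [show x * q ^ N * A * B = x * A * B * q ^ N by ring]
        exact mul_pow_mul_pow_ne_one h N k
    rw [mul_assoc x _ q, ← pow_succ] at step
    simp only [qShifted_succ]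
    linear_combination (1 - x * A * B * q ^ N) * (1 - x * q ^ N) * ih
      + qShifted (x * A) q N * qShifted (x * B) q N * step

theorem tendsto_tsum_qGaussTerm_mul_pow (hq : ‖q‖ < 1) (hx : ‖x‖ < 1)
    (h : ∀ k : ℕ, x * A * B * q ^ k ≠ 1) :
    Tendsto (fun N => ∑' m, qGaussTerm A B q (x * q ^ N) m) atTop (𝓝 1) := by
  obtain ⟨M, hM, hle⟩ := exists_norm_qGaussTerm_mul_pow_le hq h
  have termwise (m : ℕ) : Tendsto (fun N => qGaussTerm A B q (x * q ^ N) m) atTop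
      (𝓝 (if m = 0 then 1 else 0)) := by
    rcases eq_or_ne m 0 with rfl | hm
    · simp [qGaussTerm, qShifted_zero]
    · rw [if_neg hm]
      refine squeeze_zero_norm (hle · m) ?_
      have hpow := (tendsto_pow_atTop_nhds_zero_of_norm_lt_one hq).const_mul x
      simpa [hm] using (hpow.norm.pow m).const_mul M
  have := tendsto_tsum_of_dominated_convergence
    ((summable_geometric_of_lt_one (norm_nonneg x) hx).mul_left M) termwise <|
    .of_forall fun N m => (hle N m).trans <| by
      gcongr
      exact norm_mul_pow_le hq.le x N
  simpa only [tsum_ite_eq] using this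

theorem hasSum_qGaussTerm (hq : ‖q‖ < 1) (hx : ‖x‖ < 1) (h : ∀ k : ℕ, x * A * B * q ^ k ≠ 1) :
    HasSum (qGaussTerm A B q x) (qShiftedInf (x * A) q * qShiftedInf (x * B) q
      / (qShiftedInf (x * A * B) q * qShiftedInf x q)) := by
  have hlim : qShiftedInf (x * A * B) q * qShiftedInf x q * ∑' m, qGaussTerm A B q x m
      = qShiftedInf (x * A) q * qShiftedInf (x * B) q * 1 :=
    tendsto_nhds_unique
      (((tendsto_qShifted (x * A * B) q hq).mul (tendsto_qShifted x q hq)).mul_const _)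
      ((((tendsto_qShifted (x * A) q hq).mul (tendsto_qShifted (x * B) q hq)).mul
        (tendsto_tsum_qGaussTerm_mul_pow hq hx h)).congr
          fun N => (qShifted_mul_tsum_qGaussTerm hq hx h N).symm)
  have hne : qShiftedInf (x * A * B) q * qShiftedInf x q ≠ 0 :=
    mul_ne_zero (qShiftedInf_ne_zero hq h)
      (qShiftedInf_ne_zero hq (mul_pow_ne_one_of_norm_lt_one hx hq.le))
  rw [← mul_one (qShiftedInf (x * A) q * _), ← hlim, mul_div_cancel_left₀ _ hne]
  exact (summable_qGaussTerm hq hx h).hasSum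

end QGauss

section Bailey

/-- `(u, v)` is a Bailey pair relative to `c` in base `q`:
`v_n = ∑_{r ≤ n} u_r / ((q; q)_{n-r} (cq; q)_{n+r})`. The sum runs over the pairs `(r, m)` with
`r + m = n`, so that `n - r = m` and `n + r = 2r + m`. -/
def IsBaileyPair (c q : ℂ) (u v : ℕ → ℂ) : Prop :=
  ∀ n, v n = ∑ rm ∈ antidiagonal n,
    u rm.1 / (qShifted q q rm.2 * qShifted (c * q) q (2 * rm.1 + rm.2))

/-- The term with indices `(r, m)`, `r + m = n`, of the double series that results from inserting
`v_n = ∑_{r + m = n} u_r / ((q; q)_m (cq; q)_{2r+m})` into `∑_n (A; q)_n (B; q)_n x^n v_n`. -/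
noncomputable def baileySummand (A B c q x : ℂ) (u : ℕ → ℂ) (rm : ℕ × ℕ) : ℂ :=
  qShifted A q (rm.1 + rm.2) * qShifted B q (rm.1 + rm.2) * x ^ (rm.1 + rm.2)
    * (u rm.1 / (qShifted q q rm.2 * qShifted (c * q) q (2 * rm.1 + rm.2)))

variable {A B c q x : ℂ} {u v : ℕ → ℂ}

theorem summable_baileySummand (A B : ℂ) (hq : ‖q‖ < 1) (hx : ‖x‖ < 1)
    (hc : ∀ k : ℕ, c * q * q ^ k ≠ 1) (hu : Summable fun r => u r * x ^ r) :
    Summable (baileySummand A B c q x u) := by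
  obtain ⟨MA, hMA, hA⟩ := exists_norm_qShifted_le A hq
  obtain ⟨MB, hMB, hB⟩ := exists_norm_qShifted_le B hq
  obtain ⟨Mq, hMq, hqq⟩ :=
    exists_norm_inv_qShifted_le hq (mul_pow_ne_one_of_norm_lt_one hq hq.le)
  obtain ⟨Mc, -, hcq⟩ := exists_norm_inv_qShifted_le hq hc
  have hbound := (hu.norm.mul_of_nonneg (summable_geometric_of_lt_one (norm_nonneg x) hx)
    (fun _ => norm_nonneg _) (fun _ => by positivity)).mul_left (MA * MB * (Mq * Mc))
  refine .of_norm_bounded hbound fun ⟨r, m⟩ => ?_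
  have hfactor : baileySummand A B c q x u (r, m) = qShifted A q (r + m) * qShifted B q (r + m)
      * ((qShifted q q m)⁻¹ * (qShifted (c * q) q (2 * r + m))⁻¹) * (u r * x ^ r * x ^ m) := by
    simp only [baileySummand, div_eq_mul_inv, mul_inv, pow_add]
    ring
  rw [hfactor]
  simp only [norm_mul, norm_pow]
  gcongr
  exacts [hA _, hB _, hqq _, hcq _]

theorem baileySummand_eq_mul_qGaussTerm (hABc : x * A * B = c * q) (u : ℕ → ℂ) (r m : ℕ) :
    baileySummand A B c q x u (r, m)
      = qShifted A q r * qShifted B q r * x ^ r * u r / qShifted (c * q) q (2 * r)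
        * qGaussTerm (A * q ^ r) (B * q ^ r) q x m := by
  simp only [baileySummand, qGaussTerm, qShifted_add, pow_add,
    show x * (A * q ^ r) * (B * q ^ r) = x * A * B * q ^ (2 * r) by ring, hABc]
  simp only [div_eq_mul_inv, mul_inv]
  ring

theorem hasSum_baileySummand_right (hq : ‖q‖ < 1) (hx : ‖x‖ < 1) (hABc : x * A * B = c * q)
    (hc : ∀ k : ℕ, c * q * q ^ k ≠ 1) (hA : ∀ k : ℕ, x * A * q ^ k ≠ 1)
    (hB : ∀ k : ℕ, x * B * q ^ k ≠ 1) (u : ℕ → ℂ) (r : ℕ) :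
    HasSum (fun m => qShiftedInf (c * q) q * qShiftedInf x q
        / (qShiftedInf (x * A) q * qShiftedInf (x * B) q) * baileySummand A B c q x u (r, m))
      (qShifted A q r * qShifted B q r / (qShifted (x * A) q r * qShifted (x * B) q r)
        * (x ^ r * u r)) := by
  have hc_eq : x * (A * q ^ r) * (B * q ^ r) = c * q * q ^ (2 * r) := by rw [← hABc]; ring
  have hGauss := hasSum_qGaussTerm (A := A * q ^ r) (B := B * q ^ r) hq hx fun k => by
    rw [hc_eq]
    exact mul_pow_mul_pow_ne_one hc (2 * r) k
  rw [hc_eq, ← mul_assoc x A, ← mul_assoc x B] at hGauss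
  simp only [baileySummand_eq_mul_qGaussTerm hABc u r]
  convert! (hGauss.mul_left _).mul_left _ using 1
  rw [qShiftedInf_eq_qShifted_mul hq (c * q) (2 * r), qShiftedInf_eq_qShifted_mul hq (x * A) r,
    qShiftedInf_eq_qShifted_mul hq (x * B) r]
  have hxInf := qShiftedInf_ne_zero hq (mul_pow_ne_one_of_norm_lt_one hx hq.le)
  have hAInf := qShiftedInf_ne_zero hq (mul_pow_mul_pow_ne_one hA r)
  have hBInf := qShiftedInf_ne_zero hq (mul_pow_mul_pow_ne_one hB r)
  have hcInf := qShiftedInf_ne_zero hq (mul_pow_mul_pow_ne_one hc (2 * r))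
  have hcr := qShifted_ne_zero hc (2 * r)
  field_simp

theorem IsBaileyPair.sum_antidiagonal_baileySummand (h : IsBaileyPair c q u v) (A B x : ℂ)
    (n : ℕ) : ∑ rm ∈ antidiagonal n, baileySummand A B c q x u rm
      = qShifted A q n * qShifted B q n * v n * x ^ n := by
  rw [h n, mul_right_comm, mul_sum]
  refine sum_congr rfl fun rm hrm => ?_
  rw [baileySummand, mem_antidiagonal.1 hrm]

theorem IsBaileyPair.hasSum_tsum_baileySummand (h : IsBaileyPair c q u v) (A B : ℂ) (hq : ‖q‖ < 1)
    (hx : ‖x‖ < 1) (hc : ∀ k : ℕ, c * q * q ^ k ≠ 1) (hu : Summable fun r => u r * x ^ r) :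
    HasSum (fun n => qShifted A q n * qShifted B q n * v n * x ^ n)
      (∑' rm, baileySummand A B c q x u rm) := by
  simpa only [h.sum_antidiagonal_baileySummand] using
    hasSum_sum_antidiagonal (summable_baileySummand A B hq hx hc hu).hasSum

/-- Bailey's lemma. -/
theorem IsBaileyPair.hasSum (h : IsBaileyPair c q u v) (hq : ‖q‖ < 1) (hx : ‖x‖ < 1)
    (hABc : x * A * B = c * q) (hc : ∀ k : ℕ, c * q * q ^ k ≠ 1)
    (hA : ∀ k : ℕ, x * A * q ^ k ≠ 1) (hB : ∀ k : ℕ, x * B * q ^ k ≠ 1)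
    (hu : Summable fun r => u r * x ^ r) :
    HasSum (fun r => qShifted A q r * qShifted B q r
        / (qShifted (x * A) q r * qShifted (x * B) q r) * (x ^ r * u r))
      (qShiftedInf (c * q) q * qShiftedInf x q / (qShiftedInf (x * A) q * qShiftedInf (x * B) q)
        * ∑' n, qShifted A q n * qShifted B q n * v n * x ^ n) := by
  rw [(h.hasSum_tsum_baileySummand A B hq hx hc hu).tsum_eq]
  exact ((summable_baileySummand A B hq hx hc hu).hasSum.mul_left _).prod_fiberwise
    fun r => hasSum_baileySummand_right hq hx hABc hc hA hB u r

end Bailey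

section VeryWellPoised

/-- The very-well-poised factor `(1 - t p^{2r}) / (1 - t) * (t; p)_r / (p; p)_r`, with the common
factor `1 - t` cancelled so that `t = 1` yields the limit. -/
noncomputable def wellPoised (t p : ℂ) : ℕ → ℂ
  | 0 => 1
  | r + 1 => (1 - t * p ^ (2 * (r + 1))) * qShifted (t * p) p r / qShifted p p (r + 1)

/-- The reversed shifted factorial `∏_{k < r} (Z - p^k) = Z^r (1 / Z; p)_r`, which makes sense for
`Z = 0` as well. -/
noncomputable def qFalling (Z p : ℂ) (r : ℕ) : ℂ :=
  ∏ k ∈ range r, (Z - p ^ k)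

/-- The part of the `r`-th term of the very-well-poised `₆φ₅` series that depends on the three
parameters other than `t`, which are `1 / X`, `1 / Y`, `1 / Z` in the classical notation. -/
noncomputable def sixPhiFiveCore (t p X Y Z : ℂ) (r : ℕ) : ℂ :=
  (t * p) ^ r * qFalling X p r * qFalling Y p r * qFalling Z p r
    / (qShifted (t * p * X) p r * qShifted (t * p * Y) p r * qShifted (t * p * Z) p r)

/-- The antidifference that certifies the contiguous relation between the very-well-poised `₆φ₅`
series with parameters `Z` and `p Z`. -/
noncomputable def sixPhiFiveAntidiff (t p X Y Z : ℂ) : ℕ → ℂ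
  | 0 => 0
  | r + 1 => (1 - t * p * Z) * (p * Z) * t * qShifted (t * p) p r / qShifted p p r
      * sixPhiFiveCore t p X Y Z r * (X - p ^ r) * (Y - p ^ r) / (1 - t * p * Z * p ^ r)

variable {t p : ℂ}

theorem wellPoised_of_ne_one (ht : t ≠ 1) (p : ℂ) (r : ℕ) :
    wellPoised t p r = (1 - t * p ^ (2 * r)) / (1 - t) * (qShifted t p r / qShifted p p r) := by
  have ht' : 1 - t ≠ 0 := sub_ne_zero.2 ht.symm
  cases r with
  | zero => simp [wellPoised, qShifted_zero, ht']
  | succ r =>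
    rw [wellPoised, qShifted_succ' t]
    field_simp

theorem wellPoised_one (hp : ∀ k : ℕ, p * p ^ k ≠ 1) (r : ℕ) :
    wellPoised 1 p r = if r = 0 then 1 else 1 + p ^ r := by
  cases r with
  | zero => rfl
  | succ r =>
    rw [wellPoised, if_neg r.succ_ne_zero, div_eq_iff (qShifted_ne_zero hp (r + 1)), qShifted_succ]
    ring_nf

theorem exists_norm_wellPoised_le (t : ℂ) (hp : ‖p‖ < 1) :
    ∃ M > 0, ∀ r, ‖wellPoised t p r‖ ≤ M := by
  have hpow : Tendsto (fun r : ℕ => p ^ (2 * (r + 1))) atTop (𝓝 0) :=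
    (tendsto_pow_atTop_nhds_zero_of_norm_lt_one hp).comp <|
      tendsto_atTop_mono (fun r => by dsimp only [id]; omega) tendsto_id
  have hsucc : Tendsto (fun r => wellPoised t p (r + 1)) atTop
      (𝓝 ((1 - t * 0) * qShiftedInf (t * p) p / qShiftedInf p p)) :=
    (((hpow.const_mul t).const_sub 1).mul (tendsto_qShifted _ _ hp)).div
      ((tendsto_qShifted p p hp).comp (tendsto_add_atTop_nat 1))
      (qShiftedInf_ne_zero hp (mul_pow_ne_one_of_norm_lt_one hp hp.le))
  exact exists_pos_norm_le_of_tendsto ((tendsto_add_atTop_iff_nat 1).1 hsucc)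

theorem qFalling_zero (Z p : ℂ) : qFalling Z p 0 = 1 :=
  prod_range_zero _

theorem qFalling_succ (Z p : ℂ) (r : ℕ) :
    qFalling Z p (r + 1) = qFalling Z p r * (Z - p ^ r) :=
  prod_range_succ _ _

theorem qFalling_mul_succ (Z p : ℂ) (r : ℕ) :
    qFalling (p * Z) p (r + 1) = (p * Z - 1) * (p ^ r * qFalling Z p r) := by
  have hfactor (k : ℕ) : p * Z - p ^ (k + 1) = p * (Z - p ^ k) := by ring
  rw [qFalling, prod_range_succ', mul_comm, pow_zero]
  simp only [hfactor, prod_mul_distrib, prod_const, card_range, qFalling]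

theorem qFalling_pow_of_lt (p : ℂ) {n r : ℕ} (h : n < r) : qFalling (p ^ n) p r = 0 :=
  prod_eq_zero (mem_range.2 h) (sub_self _)

theorem qFalling_pow_add_mul_qShifted (q : ℂ) (m r : ℕ) :
    qFalling (q ^ (r + m)) q r * qShifted q q m
      = (-1) ^ r * q ^ r.choose 2 * qShifted q q (r + m) := by
  induction r with
  | zero => simp [qFalling_zero]
  | succ r ih =>
    rw [Nat.add_right_comm, pow_succ' q (r + m), qFalling_mul_succ, qShifted_succ, choose_two_succ,
      pow_add _ r (r.choose 2)]
    generalize qFalling (q ^ (r + m)) q r = f at *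
    linear_combination (q * q ^ (r + m) - 1) * q ^ r * ih

theorem sixPhiFive_contiguous {X Y Z : ℂ} (hp : ∀ k : ℕ, p * p ^ k ≠ 1)
    (hX : ∀ k : ℕ, t * p * X * p ^ k ≠ 1) (hY : ∀ k : ℕ, t * p * Y * p ^ k ≠ 1)
    (hZ : ∀ k : ℕ, t * p * Z * p ^ k ≠ 1) (r : ℕ) :
    (1 - t * p * X * Z) * (1 - t * p * Y * Z)
          * (wellPoised t p r * sixPhiFiveCore t p X Y (p * Z) r)
        - (1 - t * p * Z) * (1 - t * p * X * Y * Z)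
          * (wellPoised t p r * sixPhiFiveCore t p X Y Z r)
      = sixPhiFiveAntidiff t p X Y Z (r + 1) - sixPhiFiveAntidiff t p X Y Z r := by
  have hZ0 : t * p * Z ≠ 1 := by simpa only [pow_zero, mul_one] using hZ 0
  have hZ0' : 1 - t * p * Z ≠ 0 := sub_ne_zero.2 hZ0.symm
  cases r with
  | zero =>
    simp only [wellPoised, sixPhiFiveAntidiff, sixPhiFiveCore, qShifted_zero, qFalling_zero]
    field_simp
    ring
  | succ s =>
    have hPs := qShifted_ne_zero hp s
    have hXs := qShifted_ne_zero hX s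
    have hYs := qShifted_ne_zero hY s
    have hZs := qShifted_ne_zero hZ s
    have hPs1 : 1 - p * p ^ s ≠ 0 := sub_ne_zero.2 (hp s).symm
    have hXs1 : 1 - t * p * X * p ^ s ≠ 0 := sub_ne_zero.2 (hX s).symm
    have hYs1 : 1 - t * p * Y * p ^ s ≠ 0 := sub_ne_zero.2 (hY s).symm
    have hZs1 : 1 - t * p * Z * p ^ s ≠ 0 := sub_ne_zero.2 (hZ s).symm
    have hZs2 : 1 - t * p * Z * (p * p ^ s) ≠ 0 := by
      rw [← pow_succ']
      exact sub_ne_zero.2 (hZ (s + 1)).symm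
    simp only [wellPoised, sixPhiFiveAntidiff, sixPhiFiveCore, qFalling_mul_succ,
      show t * p * (p * Z) = t * p * Z * p by ring, qShifted_mul_self hZ0]
    simp only [qShifted_succ, qFalling_succ, pow_succ' _ s,
      show p ^ (2 * (s + 1)) = (p * p ^ s) ^ 2 by ring]
    generalize p ^ s = y at *
    generalize (t * p) ^ s = w at *
    generalize hd : 1 - t * p * Z * (p * y) = d at *
    field_simp
    rw [← hd]
    ring

theorem sum_sixPhiFive {X Y : ℂ} (hp : ∀ k : ℕ, p * p ^ k ≠ 1) (ht : ∀ k : ℕ, t * p * p ^ k ≠ 1)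
    (hX : ∀ k : ℕ, t * p * X * p ^ k ≠ 1) (hY : ∀ k : ℕ, t * p * Y * p ^ k ≠ 1) (n : ℕ) :
    ∑ r ∈ range (n + 1), wellPoised t p r * sixPhiFiveCore t p X Y (p ^ n) r
      = qShifted (t * p) p n * qShifted (t * p * X * Y) p n
        / (qShifted (t * p * X) p n * qShifted (t * p * Y) p n) := by
  have hXY (n : ℕ) := mul_ne_zero (qShifted_ne_zero hX n) (qShifted_ne_zero hY n)
  rw [eq_div_iff (hXY n), mul_comm]
  induction n with
  | zero => simp [qShifted_zero, wellPoised, sixPhiFiveCore, qFalling_zero]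
  | succ n ih =>
    have vanishing (r : ℕ) (hr : n < r) : sixPhiFiveCore t p X Y (p ^ n) r = 0 := by
      simp [sixPhiFiveCore, qFalling_pow_of_lt p hr]
    have telescoped := sum_congr rfl fun r (_ : r ∈ range (n + 2)) =>
      sixPhiFive_contiguous hp hX hY (mul_pow_mul_pow_ne_one ht n) r
    rw [sum_range_sub, sum_sub_distrib, ← mul_sum, ← mul_sum,
      sum_range_succ (fun r => wellPoised t p r * sixPhiFiveCore t p X Y (p ^ n) r),
      sixPhiFiveAntidiff, sixPhiFiveAntidiff, vanishing _ n.lt_succ_self, ← pow_succ'] at telescoped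
    simp only [qShifted_succ]
    linear_combination qShifted (t * p * X) p n * qShifted (t * p * Y) p n * telescoped
      + (1 - t * p * p ^ n) * (1 - t * p * X * Y * p ^ n) * ih

end VeryWellPoised

section CubeRoots

theorem exists_one_add_add_sq_eq_zero : ∃ ω : ℂ, 1 + ω + ω ^ 2 = 0 :=
  ⟨_, by simpa [sum_range_succ] using
    (Complex.isPrimitiveRoot_exp 3 three_ne_zero).geom_sum_eq_zero (by norm_num)⟩

theorem cubeRoots_mul_sub {R : Type*} [CommRing R] {ω : R} (hω : 1 + ω + ω ^ 2 = 0) (x y : R) :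
    (ω * x - y) * (ω ^ 2 * x - y) * (x - y) = x ^ 3 - y ^ 3 := by
  linear_combination (x * y ^ 2 - x ^ 2 * y * ω + x ^ 3 * (ω - 1)) * hω

variable {ω : ℂ}

theorem qShifted_mul_cubeRoots (hω : 1 + ω + ω ^ 2 = 0) (x p : ℂ) (n : ℕ) :
    qShifted (ω * x) p n * qShifted (ω ^ 2 * x) p n * qShifted x p n
      = qShifted (x ^ 3) (p ^ 3) n := by
  simp only [qShifted, ← prod_mul_distrib]
  refine prod_congr rfl fun k _ => ?_
  linear_combination -cubeRoots_mul_sub hω (x * p ^ k) 1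

theorem qFalling_mul_cubeRoots (hω : 1 + ω + ω ^ 2 = 0) (Z p : ℂ) (n : ℕ) :
    qFalling (ω * Z) p n * qFalling (ω ^ 2 * Z) p n * qFalling Z p n
      = qFalling (Z ^ 3) (p ^ 3) n := by
  simp only [qFalling, ← prod_mul_distrib]
  refine prod_congr rfl fun k _ => ?_
  rw [cubeRoots_mul_sub hω, pow_right_comm]

theorem sixPhiFiveCore_cubeRoots (hω : 1 + ω + ω ^ 2 = 0) (t p Z : ℂ) (r : ℕ) :
    sixPhiFiveCore t p (ω * Z) (ω ^ 2 * Z) Z r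
      = (t * p) ^ r * qFalling (Z ^ 3) (p ^ 3) r / qShifted ((t * p * Z) ^ 3) (p ^ 3) r := by
  rw [sixPhiFiveCore, mul_left_comm _ ω, mul_left_comm _ (ω ^ 2), qShifted_mul_cubeRoots hω,
    ← qFalling_mul_cubeRoots hω]
  ring

end CubeRoots

section CubicBaileyPair

variable {t p : ℂ}

theorem sum_wellPoised_mul_cubic (hp : ∀ k : ℕ, p ^ 3 * (p ^ 3) ^ k ≠ 1)
    (ht : ∀ k : ℕ, t ^ 3 * p ^ 3 * (p ^ 3) ^ k ≠ 1) (n : ℕ) :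
    ∑ r ∈ range (n + 1), wellPoised t p r * ((t * p) ^ r * qFalling ((p ^ 3) ^ n) (p ^ 3) r
        / qShifted (t ^ 3 * p ^ 3 * (p ^ 3) ^ n) (p ^ 3) r)
      = qShifted (t * p) p (3 * n) / qShifted (t ^ 3 * p ^ 3 * (p ^ 3) ^ n) (p ^ 3) n := by
  obtain ⟨ω, hω⟩ := exists_one_add_add_sq_eq_zero
  have hω3 : ω ^ 3 = 1 := by linear_combination (ω - 1) * hω
  have hcube : (t * p * p ^ n) ^ 3 = t ^ 3 * p ^ 3 * (p ^ 3) ^ n := by ring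
  have hroot {c : ℂ} (hc : c ^ 3 = 1) : ∀ k : ℕ, t * p * (c * p ^ n) * p ^ k ≠ 1 :=
    mul_pow_ne_one_of_pow_mul_pow_ne_one fun k => by
      rw [mul_left_comm, mul_pow c, hc, one_mul, hcube]
      exact mul_pow_mul_pow_ne_one ht n k
  have hω23 : (ω ^ 2) ^ 3 = 1 := by rw [pow_right_comm, hω3, one_pow]
  have ht' : ∀ k : ℕ, t * p * p ^ k ≠ 1 :=
    mul_pow_ne_one_of_pow_mul_pow_ne_one (n := 3) fun k => by
      simpa only [mul_pow t p 3] using ht k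
  have hsum := sum_sixPhiFive (mul_pow_ne_one_of_pow_mul_pow_ne_one hp) ht'
    (hroot hω3) (hroot hω23) n
  simp only [sixPhiFiveCore_cubeRoots hω, hcube, pow_right_comm p n 3] at hsum
  have hsplit : qShifted (t * p) p (3 * n) = qShifted (t * p) p n
      * qShifted (t * p * (ω * p ^ n) * (ω ^ 2 * p ^ n)) p n * qShifted (t * p * p ^ n) p n := by
    rw [show t * p * (ω * p ^ n) * (ω ^ 2 * p ^ n) = t * p * p ^ (n + n) * ω ^ 3 by ring, hω3,
      mul_one, mul_right_comm, ← qShifted_add, ← qShifted_add, show 3 * n = n + n + n by ring]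
  have hlast := qShifted_ne_zero (mul_pow_mul_pow_ne_one ht' n) n
  rw [hsum, hsplit, ← hcube, ← qShifted_mul_cubeRoots hω, mul_left_comm ω, mul_left_comm (ω ^ 2),
    mul_div_mul_right _ _ hlast]

theorem neg_one_pow_mul_pow_choose_two_div {q : ℂ} (hq : ∀ k : ℕ, q * q ^ k ≠ 1) (c : ℂ)
    (r m : ℕ) :
    (-1) ^ r * q ^ r.choose 2 / (qShifted q q m * qShifted c q (2 * r + m))
      = qFalling (q ^ (r + m)) q r / qShifted (c * q ^ (r + m)) q r
        / (qShifted q q (r + m) * qShifted c q (r + m)) := by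
  have hm := qShifted_ne_zero hq m
  have hrm := qShifted_ne_zero hq (r + m)
  have hratio : (-1) ^ r * q ^ r.choose 2 / qShifted q q m
      = qFalling (q ^ (r + m)) q r / qShifted q q (r + m) := by
    rw [div_eq_div_iff hm hrm, qFalling_pow_add_mul_qShifted]
  rw [show 2 * r + m = r + m + r by ring, qShifted_add c, ← div_div, hratio]
  simp only [div_eq_mul_inv, mul_inv]
  ring

/-- The sequence `α_r` of the cubic Bailey pair relative to `t ^ 3` in base `p ^ 3`. -/
noncomputable def cubicBaileyAlpha (t p : ℂ) (r : ℕ) : ℂ :=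
  (-1) ^ r * wellPoised t p r * (t * p) ^ r * (p ^ 3) ^ r.choose 2

/-- The sequence `β_n` of the cubic Bailey pair relative to `t ^ 3` in base `p ^ 3`. -/
noncomputable def cubicBaileyBeta (t p : ℂ) (n : ℕ) : ℂ :=
  qShifted (t * p) p (3 * n)
    / (qShifted (p ^ 3) (p ^ 3) n * qShifted (t ^ 3 * p ^ 3) (p ^ 3) (2 * n))

theorem isBaileyPair_cubic (hp : ∀ k : ℕ, p ^ 3 * (p ^ 3) ^ k ≠ 1)
    (ht : ∀ k : ℕ, t ^ 3 * p ^ 3 * (p ^ 3) ^ k ≠ 1) :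
    IsBaileyPair (t ^ 3) (p ^ 3) (cubicBaileyAlpha t p) (cubicBaileyBeta t p) := fun n => by
  have hterm : ∀ rm ∈ antidiagonal n, cubicBaileyAlpha t p rm.1
        / (qShifted (p ^ 3) (p ^ 3) rm.2 * qShifted (t ^ 3 * p ^ 3) (p ^ 3) (2 * rm.1 + rm.2))
      = wellPoised t p rm.1 * ((t * p) ^ rm.1 * qFalling ((p ^ 3) ^ n) (p ^ 3) rm.1
          / qShifted (t ^ 3 * p ^ 3 * (p ^ 3) ^ n) (p ^ 3) rm.1)
        / (qShifted (p ^ 3) (p ^ 3) n * qShifted (t ^ 3 * p ^ 3) (p ^ 3) n) := fun rm hrm => by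
    have hdiv := neg_one_pow_mul_pow_choose_two_div hp (t ^ 3 * p ^ 3) rm.1 rm.2
    rw [mem_antidiagonal.1 hrm] at hdiv
    rw [cubicBaileyAlpha]
    linear_combination wellPoised t p rm.1 * (t * p) ^ rm.1 * hdiv
  rw [sum_congr rfl hterm, Nat.sum_antidiagonal_eq_sum_range_succ_mk, ← sum_div,
    sum_wellPoised_mul_cubic hp ht, cubicBaileyBeta, two_mul n, qShifted_add]
  simp only [div_eq_mul_inv, mul_inv]
  ring

theorem summable_cubicBaileyAlpha_mul_pow (t x : ℂ) (hp : ‖p‖ < 1) :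
    Summable fun r => cubicBaileyAlpha t p r * x ^ r := by
  obtain ⟨M, -, hM⟩ := exists_norm_wellPoised_le t hp
  have hmajorant := summable_pow_mul_pow_choose_two (-(t * p * x))
    (norm_pow_lt_one hp three_ne_zero)
  refine .of_norm_bounded (hmajorant.norm.mul_left M) fun r => ?_
  have hfactor : cubicBaileyAlpha t p r * x ^ r
      = wellPoised t p r * ((-(t * p * x)) ^ r * (p ^ 3) ^ r.choose 2) := by
    rw [cubicBaileyAlpha, neg_pow (t * p * x), mul_pow _ x]
    ring
  rw [hfactor, norm_mul]
  gcongr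
  exact hM r

theorem pow_mul_cubicBaileyAlpha (hp : p ≠ 0) (t a b : ℂ) (n : ℕ) :
    (t ^ 3 * a * b / p ^ 3) ^ n * cubicBaileyAlpha t p n
      = (-1) ^ n * wellPoised t p n * t ^ (4 * n) * a ^ n * b ^ n
        * p ^ ((3 * (n : ℤ) ^ 2 - 7 * (n : ℤ)) / 2) := by
  rw [zpow_three_mul_sq_sub_seven_mul_div_two hp, cubicBaileyAlpha, div_pow]
  ring

theorem summable_cubicBaileyBeta (hp : ‖p‖ < 1) {x : ℂ} (hx : ‖x‖ < 1)
    (ht : ∀ k : ℕ, t ^ 3 * p ^ 3 * (p ^ 3) ^ k ≠ 1) (A B : ℂ) :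
    Summable fun n : ℕ => qShifted A (p ^ 3) n * qShifted B (p ^ 3) n * cubicBaileyBeta t p n
      * x ^ n :=
  have hq := norm_pow_lt_one hp three_ne_zero
  ((isBaileyPair_cubic (mul_pow_ne_one_of_norm_lt_one hq hq.le) ht).hasSum_tsum_baileySummand A B
    hq hx ht (summable_cubicBaileyAlpha_mul_pow t x hp)).summable

theorem hasSum_wellPoised_cubic {a b : ℂ} (hp0 : p ≠ 0) (hp : ‖p‖ < 1) (ha : a ≠ 0)
    (hb : b ≠ 0) (hx : ‖t ^ 3 * a * b / p ^ 3‖ < 1)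
    (ht : ∀ k : ℕ, t ^ 3 * p ^ 3 * (p ^ 3) ^ k ≠ 1)
    (hta : ∀ k : ℕ, t ^ 3 * a * (p ^ 3) ^ k ≠ 1) (htb : ∀ k : ℕ, t ^ 3 * b * (p ^ 3) ^ k ≠ 1) :
    HasSum (fun n : ℕ => (-1) ^ n * wellPoised t p n
        * (qShifted (p ^ 3 / a) (p ^ 3) n * qShifted (p ^ 3 / b) (p ^ 3) n
          / (qShifted (t ^ 3 * a) (p ^ 3) n * qShifted (t ^ 3 * b) (p ^ 3) n))
        * t ^ (4 * n) * a ^ n * b ^ n * p ^ ((3 * (n : ℤ) ^ 2 - 7 * (n : ℤ)) / 2))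
      (qShiftedInf (t ^ 3 * p ^ 3) (p ^ 3) * qShiftedInf (t ^ 3 * a * b / p ^ 3) (p ^ 3)
          / (qShiftedInf (t ^ 3 * a) (p ^ 3) * qShiftedInf (t ^ 3 * b) (p ^ 3))
        * ∑' n : ℕ, qShifted (p ^ 3 / a) (p ^ 3) n * qShifted (p ^ 3 / b) (p ^ 3) n
          * cubicBaileyBeta t p n * (t ^ 3 * a * b / p ^ 3) ^ n) := by
  have hq := norm_pow_lt_one hp three_ne_zero
  have hxA : t ^ 3 * a * b / p ^ 3 * (p ^ 3 / a) = t ^ 3 * b := by field_simp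
  have hxB : t ^ 3 * a * b / p ^ 3 * (p ^ 3 / b) = t ^ 3 * a := by field_simp
  have hxAB : t ^ 3 * a * b / p ^ 3 * (p ^ 3 / a) * (p ^ 3 / b) = t ^ 3 * p ^ 3 := by field_simp
  have hBailey := (isBaileyPair_cubic (mul_pow_ne_one_of_norm_lt_one hq hq.le) ht).hasSum hq hx
    hxAB ht (by rwa [hxA]) (by rwa [hxB])
    (summable_cubicBaileyAlpha_mul_pow t (t ^ 3 * a * b / p ^ 3) hp)
  simp only [hxA, hxB, pow_mul_cubicBaileyAlpha hp0] at hBailey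
  rw [mul_comm (qShiftedInf (t ^ 3 * b) _)] at hBailey
  refine hBailey.congr_fun fun n => ?_
  ring

end CubicBaileyPair

/-- Here `q3` and `α3` are arbitrary cube roots `q^{1/3}` and `α^{1/3}`. The exponent
`(3 n ^ 2 - 7 n) / 2` of `q3` is an exact integer division, as `3 n ^ 2 - 7 n` is always even, so
that `q3 ^ ((3 n ^ 2 - 7 n) / 2)` is `q^{(3 n ^ 2 - 7 n) / 6}`. The last part is the case
`α^{1/3} = 1`, in which the factor
`(1 - α^{1/3} q^{2n/3}) / (1 - α^{1/3}) * (α^{1/3}; q^{1/3})_n / (q^{1/3}; q^{1/3})_n` is read as its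
limit, namely `1` for `n = 0` and `1 + q^{n/3}` for `n ≥ 1`. -/
theorem mainTheorem10 (q α a b q3 α3 : ℂ)
    (hq0 : q ≠ 0) (hq1 : ‖q‖ < 1) (hq3 : q3 ^ 3 = q) (hα3 : α3 ^ 3 = α)
    (ha : a ≠ 0) (hb : b ≠ 0)
    (hconv : ‖α * a * b / q‖ < 1)
    (hαq : ∀ k : ℕ, α * q * q ^ k ≠ 1)
    (hαa : ∀ k : ℕ, α * a * q ^ k ≠ 1)
    (hαb : ∀ k : ℕ, α * b * q ^ k ≠ 1) :
    Summable (fun n : ℕ =>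
      qShifted (q / a) q n * qShifted (q / b) q n * qShifted (α3 * q3) q3 (3 * n)
        / (qShifted q q n * qShifted (α * q) q (2 * n)) * (α * a * b / q) ^ n) ∧
    (α3 ≠ 1 →
      Summable (fun n : ℕ =>
        (-1) ^ n * ((1 - α3 * q3 ^ (2 * n)) / (1 - α3))
          * (qShifted (q / a) q n * qShifted (q / b) q n * qShifted α3 q3 n
              / (qShifted (α * a) q n * qShifted (α * b) q n * qShifted q3 q3 n))
          * α3 ^ (4 * n) * a ^ n * b ^ n * q3 ^ ((3 * (n : ℤ) ^ 2 - 7 * (n : ℤ)) / 2)) ∧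
      qShiftedInf (α * q) q * qShiftedInf (α * a * b / q) q
          / (qShiftedInf (α * a) q * qShiftedInf (α * b) q)
        * ∑' n : ℕ,
          qShifted (q / a) q n * qShifted (q / b) q n * qShifted (α3 * q3) q3 (3 * n)
            / (qShifted q q n * qShifted (α * q) q (2 * n)) * (α * a * b / q) ^ n
      = ∑' n : ℕ,
          (-1) ^ n * ((1 - α3 * q3 ^ (2 * n)) / (1 - α3))
            * (qShifted (q / a) q n * qShifted (q / b) q n * qShifted α3 q3 n
                / (qShifted (α * a) q n * qShifted (α * b) q n * qShifted q3 q3 n))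
            * α3 ^ (4 * n) * a ^ n * b ^ n * q3 ^ ((3 * (n : ℤ) ^ 2 - 7 * (n : ℤ)) / 2)) ∧
    (α3 = 1 →
      Summable (fun n : ℕ =>
        (-1) ^ n * (if n = 0 then 1 else 1 + q3 ^ n)
          * (qShifted (q / a) q n * qShifted (q / b) q n
              / (qShifted (α * a) q n * qShifted (α * b) q n))
          * a ^ n * b ^ n * q3 ^ ((3 * (n : ℤ) ^ 2 - 7 * (n : ℤ)) / 2)) ∧
      qShiftedInf (α * q) q * qShiftedInf (α * a * b / q) q
          / (qShiftedInf (α * a) q * qShiftedInf (α * b) q)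
        * ∑' n : ℕ,
          qShifted (q / a) q n * qShifted (q / b) q n * qShifted (α3 * q3) q3 (3 * n)
            / (qShifted q q n * qShifted (α * q) q (2 * n)) * (α * a * b / q) ^ n
      = ∑' n : ℕ,
          (-1) ^ n * (if n = 0 then 1 else 1 + q3 ^ n)
            * (qShifted (q / a) q n * qShifted (q / b) q n
                / (qShifted (α * a) q n * qShifted (α * b) q n))
            * a ^ n * b ^ n * q3 ^ ((3 * (n : ℤ) ^ 2 - 7 * (n : ℤ)) / 2)) := by
  subst hq3 hα3
  have hp0 : q3 ≠ 0 := fun h => hq0 (by rw [h, zero_pow three_ne_zero])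
  have hp : ‖q3‖ < 1 := by
    rwa [norm_pow, pow_lt_one_iff_of_nonneg (norm_nonneg q3) three_ne_zero] at hq1
  have hleft := summable_cubicBaileyBeta hp hconv hαq (q3 ^ 3 / a) (q3 ^ 3 / b)
  have hright := hasSum_wellPoised_cubic hp0 hp ha hb hconv hαq hαa hαb
  simp only [cubicBaileyBeta, ← mul_div_assoc _ (qShifted _ q3 _)] at hleft hright
  refine ⟨hleft, fun hα => ?_, fun hα => ?_⟩
  · suffices h : HasSum _ _ from ⟨h.summable, h.tsum_eq.symm⟩
    refine hright.congr_fun fun n => ?_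
    rw [wellPoised_of_ne_one hα]
    simp only [div_eq_mul_inv, mul_inv]
    ring
  · subst hα
    simp only [wellPoised_one (mul_pow_ne_one_of_norm_lt_one hp hp.le), one_pow, mul_one] at hright
    simpa only [one_pow] using! ⟨hright.summable, hright.tsum_eq.symm⟩
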